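/- **Model.** Let $X_1,X_2,\dots$ be i.i.d. with distribution $F_0$ on $[0,\infty)$ and, independently of this sequence, let $T_1,T_2,\dots$ be i.i.d. with distribution $G$ on $[0,\infty)$. Put $\Delta_j=1_{\{X_j\le T_j\}}$; the observations are $(T_j,\Delta_j)$, $j=1,\dots,n$. **Assumptions.** * (F.1) $F_0$ has support $[0,M_0]$, is strictly increasing on $[0,M_0]$, and has a Lebesgue density $f_0$ with $f_0\ge\varepsilon$ on $[0,M_0]$ for some $\varepsilon>0$. * (G.1) $G$ has support $[0,\infty)$, is strictly increasing on $[0,M_0]$, and has a Lebesgue density $g$ such that $g\ge\varepsilon$ on $[0,M_0]$ for some $\varepsilon>0$, and $g$ is differentiable on $[0,M_0]$ (one-sidedly at the end points) with bounded derivative $g'$ there. * (K.1) $k$ is a probability density on $\mathbb R$ with support $[-1,1]$, symmetric and twice continuously differentiable on $\mathbb R$. **Estimators.** For a bandwidth $h>0$ and $i\in\{0,1\}$ let $$\hat g_{n,i}(t)=\frac1n\sum_{j\le n:\,\Delta_j=i}\frac1h\,k\!\left(\frac{t-T_j}{h}\right)\quad(t>h),\qquad \hat g_{n,i}(t)=\frac1n\sum_{j\le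 n:\,\Delta_j=i}\frac1h\,k^{t/h}\!\left(\frac{t-T_j}{h}\right)\quad(0\le t\le h),$$ where $k^\beta$ is the boundary kernel $$k^\beta(u)=\frac{\nu_{2,\beta}-\nu_{1,\beta}u}{\nu_{0,\beta}\nu_{2,\beta}-\nu_{1,\beta}^2}\,k(u)\,1_{(-1,\beta)}(u),\qquad \nu_{i,\beta}=\int_{-1}^{\beta}u^ik(u)\,du .$$ Put $\hat g_n=\hat g_{n,0}+\hat g_{n,1}$ and $\hat F_n^{\mathrm{naive}}=\hat g_{n,1}/\hat g_n$. **Theorem 3.3.** Assume (F.1), (G.1) and (K.1), and let $h=h_n=c\,n^{-\alpha}$ with $c>0$ and $\alpha\in(0,1/3)$. Then for all $0<m<M<M_0$, $$P\bigl(\hat g_n>0 \text{ on } [m,M]\text{, so that }\hat F_n^{\mathrm{naive}}\text{ is well defined there, and }\hat F_n^{\mathrm{naive}}\text{ is monotonically increasing (nondecreasing) on }[m,M]\bigr)\longrightarrow 1\qquad(n\to\infty).$$ -/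

import Mathlib

open MeasureTheory ProbabilityTheory Filter Topology Set

open scoped ENNReal

noncomputable section

/-- The current status indicator `Δ = 1_{X ≤ T}`, with values in `{0, 1}`. -/
def currentStatus (x t : ℝ) : Fin 2 := if x ≤ t then 1 else 0

/-- The current status model: `X 0, X 1, …` are i.i.d. with distribution `F₀`, `T 0, T 1, …` are
i.i.d. with distribution `G`, and the two sequences are independent of each other. The sample of
size `n` consists of the observations `(T j, currentStatus (X j) (T j))` with `j < n`. -/
structure IsCurrentStatusModel {Ω : Type*} [MeasurableSpace Ω] (P : Measure Ω)
    (F₀ G : Measure ℝ) (X T : ℕ → Ω → ℝ) : Prop where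
  measurable_X : ∀ j, Measurable (X j)
  measurable_T : ∀ j, Measurable (T j)
  law_X : ∀ j, P.map (X j) = F₀
  law_T : ∀ j, P.map (T j) = G
  indep_X : iIndepFun X P
  indep_T : iIndepFun T P
  indep_X_T : IndepFun (fun ω j => X j ω) (fun ω j => T j ω) P

/-- The condition on the event time distribution `F₀`: it has support `[0, M₀]`, is strictly
increasing there, and has a Lebesgue density `f₀` that stays away from zero on the support. -/
structure EventTimeCondition (F₀ : Measure ℝ) (f₀ : ℝ → ℝ) (M₀ : ℝ) : Prop where
  support_eq : F₀.support = Icc 0 M₀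
  strictMonoOn_cdf : StrictMonoOn (cdf F₀) (Icc 0 M₀)
  measurable_density : Measurable f₀
  density_nonneg : ∀ x, 0 ≤ f₀ x
  eq_withDensity : F₀ = volume.withDensity (fun x => ENNReal.ofReal (f₀ x))
  away_from_zero : ∃ ε > 0, ∀ x ∈ Icc 0 M₀, ε ≤ f₀ x

/-- The condition on the censoring distribution `G`: it has support `[0, ∞)`, is strictly
increasing on `[0, M₀]`, and has a Lebesgue density `g` which on `[0, M₀]` stays away from zero and
is differentiable (one-sidedly at the end points) with a bounded derivative. -/
structure CensoringCondition (G : Measure ℝ) (g : ℝ → ℝ) (M₀ : ℝ) : Prop where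
  support_eq : G.support = Ici 0
  strictMonoOn_cdf : StrictMonoOn (cdf G) (Icc 0 M₀)
  measurable_density : Measurable g
  density_nonneg : ∀ t, 0 ≤ g t
  eq_withDensity : G = volume.withDensity (fun t => ENNReal.ofReal (g t))
  away_from_zero : ∃ ε > 0, ∀ t ∈ Icc 0 M₀, ε ≤ g t
  differentiableOn : DifferentiableOn ℝ g (Icc 0 M₀)
  bounded_deriv : ∃ B : ℝ, ∀ t ∈ Icc 0 M₀, |derivWithin g (Icc 0 M₀) t| ≤ B

/-- The condition on the kernel: a symmetric probability density with (closed) support `[-1, 1]`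
that is twice continuously differentiable on the whole line. -/
structure KernelCondition (k : ℝ → ℝ) : Prop where
  nonneg : ∀ u, 0 ≤ k u
  integral_eq_one : ∫ u, k u = 1
  tsupport_eq : tsupport k = Icc (-1) 1
  symmetric : ∀ u, k (-u) = k u
  contDiff : ContDiff ℝ 2 k

/-- The measure `d𝔾_{n,i}` of the empirical sub-distribution function of those among the first `n`
observation times `t j` for which the status `δ j` equals `i`: mass `1 / n` at each of them. -/
def empiricalSub (t : ℕ → ℝ) (δ : ℕ → Fin 2) (n : ℕ) (i : Fin 2) : Measure ℝ :=
  (n : ℝ≥0∞)⁻¹ • ∑ j ∈ Finset.range n, if δ j = i then Measure.dirac (t j) else 0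

/-- Integrals with respect to the empirical sub-distribution are normalized finite sums. -/
theorem integral_empiricalSub (t : ℕ → ℝ) (δ : ℕ → Fin 2) (n : ℕ) (i : Fin 2) (φ : ℝ → ℝ) :
    ∫ u, φ u ∂(empiricalSub t δ n i) =
      (n : ℝ)⁻¹ * ∑ j ∈ Finset.range n, if δ j = i then φ (t j) else 0 := by
  unfold empiricalSub
  rw [integral_smul_measure, integral_finsetSum_measure]
  · simp only [ENNReal.toReal_inv, ENNReal.toReal_natCast, smul_eq_mul]
    congr 1
    refine Finset.sum_congr rfl fun j _ => ?_
    split_ifs <;> simp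
  · intro j _
    split_ifs
    · exact integrable_dirac (by simp)
    · exact integrable_zero_measure

/-- The scaled kernel `k_h(u) = k(u / h) / h`. -/
def scaledKernel (k : ℝ → ℝ) (h u : ℝ) : ℝ := 1 / h * k (u / h)

/-- The partial moments `ν_{i,β}(k) = ∫_{-1}^β u^i k(u) du`. -/
def kernelMoment (k : ℝ → ℝ) (i : ℕ) (β : ℝ) : ℝ := ∫ u in (-1 : ℝ)..β, u ^ i * k u

/-- The boundary kernel `k^β`. -/
def boundaryKernel (k : ℝ → ℝ) (β u : ℝ) : ℝ :=
  (kernelMoment k 2 β - kernelMoment k 1 β * u) /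
      (kernelMoment k 0 β * kernelMoment k 2 β - kernelMoment k 1 β ^ 2) *
    k u * (Ioo (-1) β).indicator 1 u

/-- The boundary corrected kernel estimator with kernel `k` and bandwidth `h`, applied to the
(empirical) measure `μ` on `[0, ∞)`, as a function of `t ≥ 0`. -/
def kernelEstimator (k : ℝ → ℝ) (h : ℝ) (μ : Measure ℝ) (t : ℝ) : ℝ :=
  if t ≤ h then ∫ u, 1 / h * boundaryKernel k (t / h) ((t - u) / h) ∂μ
  else ∫ u, scaledKernel k h (t - u) ∂μ

/-- The estimator `ĝ_{n,i}` of the sub-density of the observation times with status `i`, based on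
event times `x j` and observation times `t j`, `j < n`. It depends on the event times only through
the current status indicators. -/
def gHatSub (k : ℝ → ℝ) (h : ℝ) (x t : ℕ → ℝ) (n : ℕ) (i : Fin 2) : ℝ → ℝ :=
  kernelEstimator k h (empiricalSub t (fun j => currentStatus (x j) (t j)) n i)

/-- The estimator `ĝ_n = ĝ_{n,1} + ĝ_{n,0}` of the density of the observation times. -/
def gHat (k : ℝ → ℝ) (h : ℝ) (x t : ℕ → ℝ) (n : ℕ) (s : ℝ) : ℝ :=
  gHatSub k h x t n 1 s + gHatSub k h x t n 0 s

/-- The naive estimator `ĝ_{n,1} / ĝ_n`. -/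
def naiveEstimator (k : ℝ → ℝ) (h : ℝ) (x t : ℕ → ℝ) (n : ℕ) (s : ℝ) : ℝ :=
  gHatSub k h x t n 1 s / gHat k h x t n s

/-- The bandwidth `h = c n^{-α}`. -/
def bandwidth (c α : ℝ) (n : ℕ) : ℝ := c * (n : ℝ) ^ (-α)

end

/-! Once `h < m` the boundary kernel plays no role on `[m, M]`: numerator N and denominator D of the
naive estimator are plain kernel sums, smooth in s, and where D > 0 the derivative of N / D has the
sign of N' - l D' with l = N / D. For a frozen number l this expression is linear in the sample, and
its population counterpart is the integral of (F₀ - l) k'((s - u) / h) / h² against G, i.e. the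
derivative of the smoothed function (F₀ - l) g.

That derivative is bounded below without differentiating F₀. Increments of F₀ grow at rate at least
ε₁, g is at least ε₂ and B-Lipschitz; hence if l is within δ of F₀ on the kernel window, the
derivative is at least ε₁ε₂ - δB (`le_integral_sub_mul_deriv_kernel`). The random l does lie that
close to F₀, by consistency of the quotient (`abs_div_sub_le_of_abs_sub_le`) and uniform continuity
of F₀.

It remains to control four kernel averages, with kernel k or k' and weight 1 or the indicator of X ≤
T, uniformly over `[m, M]`. A Bernstein bound at a single point has an exponent of order n h³, and a
grid of order n points suffices by Lipschitz continuity. Since n h³ = c³ n^(1 - 3α) is a positive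
power of n, the factor n from the union bound is harmless; this is where α < 1/3 enters. The
deterministic conclusion is `pos_and_monotoneOn_naiveEstimator`. -/

/-! ### Bernstein inequalities for bounded independent variables. -/

/-- The quadratic bound `exp x ≤ 1 + x + x²` near zero, integrated. -/
theorem mgf_sub_integral_le {Ω : Type*} [MeasurableSpace Ω] {P : Measure Ω}
    [IsProbabilityMeasure P] {Y : Ω → ℝ} (hY : Measurable Y) {b v l : ℝ}
    (hb : ∀ ω, |Y ω| ≤ b) (hv : ∫ ω, Y ω ^ 2 ∂P ≤ v) (hl : 2 * b * |l| ≤ 1) :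
    mgf (fun ω => Y ω - ∫ ω', Y ω' ∂P) P l ≤ Real.exp (l ^ 2 * v) := by
  have hYi : Integrable Y P :=
    Integrable.of_bound hY.aestronglyMeasurable b (ae_of_all _ fun ω => by simpa using hb ω)
  have hY2i : Integrable (fun ω => Y ω ^ 2) P := by
    refine Integrable.of_bound (by fun_prop) (b ^ 2) (ae_of_all _ fun ω => ?_)
    rw [Real.norm_eq_abs, abs_pow]
    exact pow_le_pow_left₀ (abs_nonneg _) (hb ω) 2
  set e := ∫ ω', Y ω' ∂P with he
  have heb : |e| ≤ b := by
    have := norm_integral_le_of_norm_le_const (μ := P) (f := Y) (C := b)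
      (ae_of_all _ fun ω => by simpa using hb ω)
    simpa using this
  have hab : ∀ ω, |l * (Y ω - e)| ≤ 1 := fun ω => by
    rw [abs_mul]
    have h1 : |Y ω - e| ≤ 2 * b := (abs_sub _ _).trans (by linarith [hb ω])
    nlinarith [abs_nonneg l]
  have hpt : ∀ ω, Real.exp (l * (Y ω - e)) ≤
      1 + l * (Y ω - e) + l ^ 2 * (Y ω ^ 2 - 2 * e * Y ω + e ^ 2) := fun ω => by
    have := (abs_le.1 (Real.abs_exp_sub_one_sub_id_le (hab ω))).2
    nlinarith
  have hint : Integrable (fun ω => 1 + l * (Y ω - e) +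
      l ^ 2 * (Y ω ^ 2 - 2 * e * Y ω + e ^ 2)) P := by fun_prop
  calc mgf (fun ω => Y ω - e) P l
      ≤ ∫ ω, (1 + l * (Y ω - e) + l ^ 2 * (Y ω ^ 2 - 2 * e * Y ω + e ^ 2)) ∂P :=
        integral_mono_of_nonneg (ae_of_all _ fun ω => (Real.exp_pos _).le) hint
          (ae_of_all _ hpt)
    _ = 1 + l ^ 2 * ((∫ ω, Y ω ^ 2 ∂P) - e ^ 2) := by
        rw [integral_add (by fun_prop) (by fun_prop), integral_add (by fun_prop) (by fun_prop),
          integral_const_mul, integral_const_mul, integral_sub (by fun_prop) (by fun_prop),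
          integral_add (by fun_prop) (by fun_prop), integral_sub (by fun_prop) (by fun_prop),
          integral_const_mul, ← he]
        simp only [integral_const, probReal_univ, one_smul]
        ring
    _ ≤ l ^ 2 * v + 1 := by nlinarith [sq_nonneg l, sq_nonneg e, mul_nonneg (sq_nonneg l) (sq_nonneg e)]
    _ ≤ Real.exp (l ^ 2 * v) := Real.add_one_le_exp _

/-- A one-sided Bernstein inequality with free parameter. -/
theorem measureReal_le_sum_sub_integral_le {Ω : Type*} [MeasurableSpace Ω] {P : Measure Ω}
    [IsProbabilityMeasure P] {Y : ℕ → Ω → ℝ} (hY : ∀ j, Measurable (Y j)) (hind : iIndepFun Y P)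
    {b v l : ℝ} (hb : ∀ j ω, |Y j ω| ≤ b) (hv : ∀ j, ∫ ω, Y j ω ^ 2 ∂P ≤ v)
    (hl0 : 0 ≤ l) (hl : 2 * b * l ≤ 1) (n : ℕ) (η : ℝ) :
    P.real {ω | n * η ≤ ∑ j ∈ Finset.range n, (Y j ω - ∫ ω', Y j ω' ∂P)} ≤
      Real.exp (n * (l ^ 2 * v - l * η)) := by
  set Z : ℕ → Ω → ℝ := fun j ω => Y j ω - ∫ ω', Y j ω' ∂P with hZ
  have hZm : ∀ j, Measurable (Z j) := fun j => (hY j).sub_const _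
  have hZind : iIndepFun Z P := hind.comp (fun j y => y - ∫ ω', Y j ω' ∂P)
    (fun j => measurable_id.sub_const _)
  have hsum : mgf (∑ j ∈ Finset.range n, Z j) P l ≤ Real.exp (n * (l ^ 2 * v)) := by
    rw [hZind.mgf_sum hZm, Real.exp_nat_mul]
    refine (Finset.prod_le_prod (fun _ _ => mgf_nonneg) fun j _ => ?_).trans_eq
      (by rw [Finset.prod_const, Finset.card_range])
    exact mgf_sub_integral_le (hY j) (hb j) (hv j) (by rwa [abs_of_nonneg hl0])
  have hi : Integrable (fun ω => Real.exp (l * (∑ j ∈ Finset.range n, Z j) ω)) P :=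
    hZind.integrable_exp_mul_sum hZm fun j _ => by
      refine Integrable.of_bound (by fun_prop) (Real.exp (l * (b + |∫ ω', Y j ω' ∂P|)))
        (ae_of_all _ fun ω => ?_)
      rw [Real.norm_eq_abs, Real.abs_exp]
      refine Real.exp_le_exp.2 (mul_le_mul_of_nonneg_left ?_ hl0)
      simp only [hZ]
      linarith [le_abs_self (Y j ω), hb j ω, neg_abs_le (∫ ω', Y j ω' ∂P)]
  have := measure_ge_le_exp_mul_mgf (μ := P) (n * η) hl0 hi
  simp only [Finset.sum_apply] at this
  refine this.trans ?_
  calc _ ≤ Real.exp (-l * (n * η)) * Real.exp (n * (l ^ 2 * v)) := by gcongr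
    _ = _ := by rw [← Real.exp_add]; ring_nf

/-- A two-sided Bernstein inequality with free parameter. -/
theorem measureReal_le_abs_sum_sub_integral_le {Ω : Type*} [MeasurableSpace Ω] {P : Measure Ω}
    [IsProbabilityMeasure P] {Y : ℕ → Ω → ℝ} (hY : ∀ j, Measurable (Y j)) (hind : iIndepFun Y P)
    {b v l : ℝ} (hb : ∀ j ω, |Y j ω| ≤ b) (hv : ∀ j, ∫ ω, Y j ω ^ 2 ∂P ≤ v)
    (hl0 : 0 ≤ l) (hl : 2 * b * l ≤ 1) (n : ℕ) (η : ℝ) :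
    P.real {ω | n * η ≤ |∑ j ∈ Finset.range n, (Y j ω - ∫ ω', Y j ω' ∂P)|} ≤
      2 * Real.exp (n * (l ^ 2 * v - l * η)) := by
  have h1 := measureReal_le_sum_sub_integral_le hY hind hb hv hl0 hl n η
  have h2 := measureReal_le_sum_sub_integral_le (Y := fun j ω => -Y j ω) (fun j => (hY j).neg)
    (hind.comp (fun _ y => -y) fun _ => measurable_neg) (b := b) (v := v)
    (by simpa using hb) (by simpa using hv) hl0 hl n η
  have hsub : {ω | n * η ≤ |∑ j ∈ Finset.range n, (Y j ω - ∫ ω', Y j ω' ∂P)|} ⊆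
      {ω | n * η ≤ ∑ j ∈ Finset.range n, (Y j ω - ∫ ω', Y j ω' ∂P)} ∪
      {ω | n * η ≤ ∑ j ∈ Finset.range n, (-Y j ω - ∫ ω', -Y j ω' ∂P)} := by
    intro ω hω
    rcases le_abs.1 (mem_ofPred_eq ▸ hω) with h | h
    · exact Or.inl h
    · refine Or.inr ?_
      simp only [mem_ofPred_eq, integral_neg]
      refine h.trans_eq ?_
      rw [← Finset.sum_neg_distrib]
      exact Finset.sum_congr rfl fun j _ => by ring
  exact ((measureReal_mono hsub).trans (measureReal_union_le _ _)).trans (by linarith)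

/-! ### Independence of the observation pairs. -/

/-- If two independent sequences both consist of independent variables, so does the sequence of
pairs. -/
theorem ProbabilityTheory.iIndepFun.prodMk_of_indepFun {Ω ι β γ : Type*} [MeasurableSpace Ω]
    [MeasurableSpace β] [MeasurableSpace γ] {P : Measure Ω} [IsProbabilityMeasure P]
    {X : ι → Ω → β} {T : ι → Ω → γ}
    (hXm : ∀ j, Measurable (X j)) (hTm : ∀ j, Measurable (T j))
    (hX : iIndepFun X P) (hT : iIndepFun T P)
    (hXT : IndepFun (fun ω j => X j ω) (fun ω j => T j ω) P) :
    iIndepFun (fun j ω => (X j ω, T j ω)) P := by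
  have hpair : ∀ j, IndepFun (X j) (T j) P := fun j =>
    hXT.comp (measurable_pi_apply j) (measurable_pi_apply j)
  -- It suffices to test independence on preimages of measurable rectangles, a π-system generating
  -- the σ-algebra of each pair. There the probability factors first between the two sequences, then
  -- within each.
  refine (iIndepFun_iff_iIndep _ _ _).2 ?_
  refine iIndepSets.iIndep (fun j => ((hXm j).prodMk (hTm j)).comap_le)
    (fun j => preimage (fun ω => (X j ω, T j ω)) ''
      (image2 (· ×ˢ ·) {s : Set β | MeasurableSet s} {t : Set γ | MeasurableSet t}))
    (fun j => isPiSystem_prod.comap _) (fun j => ?_) ?_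
  · rw [← generateFrom_prod, MeasurableSpace.comap_generateFrom]
  · rw [iIndepSets_iff]
    intro S f hf
    choose! u hu hfu using hf
    simp only [mem_image2] at hu
    choose! A hA B hB hAB using hu
    have hfe : ∀ i ∈ S, f i = X i ⁻¹' A i ∩ T i ⁻¹' B i := fun i hi => by
      rw [← hfu i hi, ← hAB i hi]; rfl
    have h1 : (⋂ i ∈ S, f i) = (⋂ i ∈ S, X i ⁻¹' A i) ∩ ⋂ i ∈ S, T i ⁻¹' B i := by
      rw [iInter₂_congr hfe]
      ext ω
      simp only [mem_iInter, mem_inter_iff]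
      exact ⟨fun h => ⟨fun i hi => (h i hi).1, fun i hi => (h i hi).2⟩,
        fun h i hi => ⟨h.1 i hi, h.2 i hi⟩⟩
    have h2 : P ((⋂ i ∈ S, X i ⁻¹' A i) ∩ ⋂ i ∈ S, T i ⁻¹' B i) =
        P (⋂ i ∈ S, X i ⁻¹' A i) * P (⋂ i ∈ S, T i ⁻¹' B i) := by
      have := hXT.measure_inter_preimage_eq_mul (⋂ i ∈ S, (fun x => x i) ⁻¹' A i)
        (⋂ i ∈ S, (fun x => x i) ⁻¹' B i)
        (Finset.measurableSet_biInter _ fun i hi => measurable_pi_apply i (hA i hi))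
        (Finset.measurableSet_biInter _ fun i hi => measurable_pi_apply i (hB i hi))
      simpa only [preimage_iInter, preimage_preimage] using this
    rw [h1, h2, hX.measure_inter_preimage_eq_mul S hA, hT.measure_inter_preimage_eq_mul S hB,
      ← Finset.prod_mul_distrib]
    refine Finset.prod_congr rfl fun i hi => ?_
    rw [hfe i hi, (hpair i).measure_inter_preimage_eq_mul _ _ (hA i hi) (hB i hi)]

/-! ### Uniform deviation of weighted kernel averages. -/

/-- The weighted kernel average `n⁻¹ ∑ w_j q((s - t_j) / h) / h²`. -/
noncomputable def kernelAverage (q : ℝ → ℝ) (h : ℝ) (w t : ℕ → ℝ) (n : ℕ) (s : ℝ) : ℝ :=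
  (n : ℝ)⁻¹ * ∑ j ∈ Finset.range n, w j * q ((s - t j) / h) / h ^ 2

theorem abs_kernelAverage_sub_le {q : ℝ → ℝ} {L : ℝ} (hL : ∀ x y, |q x - q y| ≤ L * |x - y|)
    {h : ℝ} (hh : 0 < h) {w t : ℕ → ℝ} (hw : ∀ j, |w j| ≤ 1) {n : ℕ} (s s' : ℝ) :
    |kernelAverage q h w t n s - kernelAverage q h w t n s'| ≤ L / h ^ 3 * |s - s'| := by
  have hL0 : 0 ≤ L := by
    have := (abs_nonneg _).trans (hL 1 0)
    simpa using this
  have hterm : ∀ j, |w j * q ((s - t j) / h) / h ^ 2 - w j * q ((s' - t j) / h) / h ^ 2| ≤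
      L / h ^ 3 * |s - s'| := fun j => by
    have h1 : |q ((s - t j) / h) - q ((s' - t j) / h)| ≤ L * (|s - s'| / h) := by
      refine (hL _ _).trans_eq ?_
      rw [← sub_div, abs_div, abs_of_pos hh]
      ring_nf
    rw [show w j * q ((s - t j) / h) / h ^ 2 - w j * q ((s' - t j) / h) / h ^ 2 =
      w j * (q ((s - t j) / h) - q ((s' - t j) / h)) / h ^ 2 by ring, abs_div, abs_mul,
      abs_of_pos (pow_pos hh 2)]
    calc _ ≤ 1 * (L * (|s - s'| / h)) / h ^ 2 := by
          gcongr
          exact hw j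
      _ = _ := by field_simp
  unfold kernelAverage
  rw [← mul_sub, ← Finset.sum_sub_distrib, abs_mul, abs_of_nonneg (by positivity)]
  rcases Nat.eq_zero_or_pos n with rfl | hn
  · simp; positivity
  calc _ ≤ (n : ℝ)⁻¹ * ∑ j ∈ Finset.range n, L / h ^ 3 * |s - s'| := by
        gcongr
        exact (Finset.abs_sum_le_sum_abs _ _).trans (Finset.sum_le_sum fun j _ => hterm j)
    _ = _ := by
        rw [Finset.sum_const, Finset.card_range, nsmul_eq_mul]
        field_simp

section Deviation

variable {Ω : Type*} [MeasurableSpace Ω] {P : Measure Ω} [IsProbabilityMeasure P]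
  {W T : ℕ → Ω → ℝ} {q : ℝ → ℝ}

/-- The summands are bounded by K / h², but they vanish unless T falls in a window of length 2h, so
their second moment is only of order h⁻³. Bernstein's inequality with this variance gives an
exponent proportional to n h³. -/
theorem measureReal_le_abs_kernelAverage_sub_le
    (hW : ∀ j, Measurable (W j)) (hT : ∀ j, Measurable (T j)) (hW1 : ∀ j ω, |W j ω| ≤ 1)
    (hind : iIndepFun (fun j ω => (W j ω, T j ω)) P) (hq : Measurable q)
    {K : ℝ} (hK : ∀ u, |q u| ≤ K) (hq0 : ∀ u, u ∉ Icc (-1 : ℝ) 1 → q u = 0)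
    {h s C a e η : ℝ} (hh : 0 < h) (hC : ∀ j, P.real (T j ⁻¹' Icc (s - h) (s + h)) ≤ C * h)
    (ha : 0 ≤ a) (hah : 2 * K * a * h ≤ 1)
    (he : ∀ j, ∫ ω, W j ω * q ((s - T j ω) / h) / h ^ 2 ∂P = e) {n : ℕ} (hn : 0 < n) :
    P.real {ω | η ≤ |kernelAverage q h (fun j => W j ω) (fun j => T j ω) n s - e|} ≤
      2 * Real.exp (n * h ^ 3 * (a ^ 2 * (K ^ 2 * C) - a * η)) := by
  set Y : ℕ → Ω → ℝ := fun j ω => W j ω * q ((s - T j ω) / h) / h ^ 2 with hYdef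
  have hY : ∀ j, Measurable (Y j) := fun j =>
    ((hW j).mul (hq.comp (((hT j).const_sub s).div_const h))).div_const _
  have hYind : iIndepFun Y P := hind.comp (fun _ p => p.1 * q ((s - p.2) / h) / h ^ 2)
    fun _ => (measurable_fst.mul (hq.comp ((measurable_snd.const_sub s).div_const h))).div_const _
  have hK0 : 0 ≤ K := (abs_nonneg _).trans (hK 0)
  have hb : ∀ j ω, |Y j ω| ≤ K / h ^ 2 := fun j ω => by
    simp only [hYdef]
    rw [abs_div, abs_mul, abs_of_pos (pow_pos hh 2)]
    gcongr
    calc _ ≤ 1 * K := mul_le_mul (hW1 j ω) (hK _) (abs_nonneg _) zero_le_one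
      _ = K := one_mul K
  have hv : ∀ j, ∫ ω, Y j ω ^ 2 ∂P ≤ K ^ 2 * C / h ^ 3 := fun j => by
    have hset : MeasurableSet (T j ⁻¹' Icc (s - h) (s + h)) := hT j measurableSet_Icc
    have hpt : ∀ ω, Y j ω ^ 2 ≤
        (T j ⁻¹' Icc (s - h) (s + h)).indicator (fun _ => (K / h ^ 2) ^ 2) ω := fun ω => by
      by_cases hω : ω ∈ T j ⁻¹' Icc (s - h) (s + h)
      · rw [indicator_of_mem hω, ← sq_abs]
        exact pow_le_pow_left₀ (abs_nonneg _) (hb j ω) 2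
      · rw [indicator_of_notMem hω]
        have : q ((s - T j ω) / h) = 0 := hq0 _ fun hmem => hω ⟨by
          have := (div_le_iff₀ hh).1 hmem.2
          linarith, by
          have := (le_div_iff₀ hh).1 hmem.1
          linarith⟩
        simp [hYdef, this]
    calc ∫ ω, Y j ω ^ 2 ∂P ≤
          ∫ ω, (T j ⁻¹' Icc (s - h) (s + h)).indicator (fun _ => (K / h ^ 2) ^ 2) ω ∂P :=
          integral_mono_of_nonneg (ae_of_all _ fun ω => sq_nonneg _)
            ((integrable_const _).indicator hset) (ae_of_all _ hpt)
      _ = P.real (T j ⁻¹' Icc (s - h) (s + h)) * (K / h ^ 2) ^ 2 := by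
          rw [integral_indicator_const _ hset, smul_eq_mul]
      _ ≤ C * h * (K / h ^ 2) ^ 2 := by gcongr; exact hC j
      _ = _ := by field_simp
  -- The choice l = a h³ balances a variance of order h⁻³: both l² v and l η become multiples of h³,
  -- and the constraint 2 b l ≤ 1 reduces to 2 K a h ≤ 1.
  have key := measureReal_le_abs_sum_sub_integral_le hY hYind hb hv (l := a * h ^ 3)
    (by positivity) (by
      calc 2 * (K / h ^ 2) * (a * h ^ 3) = 2 * K * a * h := by field_simp
        _ ≤ 1 := hah) n η
  refine le_trans (measureReal_mono fun ω hω => ?_) (key.trans_eq ?_)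
  · have hn' : (0 : ℝ) < n := by exact_mod_cast hn
    simp only [mem_ofPred_eq] at hω ⊢
    simp only [hYdef, he] at *
    calc n * η ≤ n * |kernelAverage q h (fun j => W j ω) (fun j => T j ω) n s - e| := by gcongr
      _ = |n * (kernelAverage q h (fun j => W j ω) (fun j => T j ω) n s - e)| := by
          rw [abs_mul, abs_of_pos hn']
      _ = _ := by
          congr 1
          rw [Finset.sum_sub_distrib, Finset.sum_const, Finset.card_range, nsmul_eq_mul,
            kernelAverage]
          field_simp
  · congr 2
    field_simp

theorem abs_integral_kernel_sub_le (hW : ∀ j, Measurable (W j)) (hT : ∀ j, Measurable (T j))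
    (hW1 : ∀ j ω, |W j ω| ≤ 1) (hq : Measurable q) {K L : ℝ} (hK : ∀ u, |q u| ≤ K)
    (hL : ∀ x y, |q x - q y| ≤ L * |x - y|) {h : ℝ} (hh : 0 < h) (s s' : ℝ) (j : ℕ) :
    |(∫ ω, W j ω * q ((s - T j ω) / h) / h ^ 2 ∂P) -
      ∫ ω, W j ω * q ((s' - T j ω) / h) / h ^ 2 ∂P| ≤ L / h ^ 3 * |s - s'| := by
  have hint : ∀ r, Integrable (fun ω => W j ω * q ((r - T j ω) / h) / h ^ 2) P := fun r => by
    refine Integrable.of_bound (C := K / h ^ 2) (((hW j).mul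
      (hq.comp (((hT j).const_sub r).div_const h))).div_const _).aestronglyMeasurable
      (ae_of_all _ fun ω => ?_)
    rw [Real.norm_eq_abs, abs_div, abs_mul, abs_of_pos (pow_pos hh 2)]
    gcongr
    calc _ ≤ 1 * K := mul_le_mul (hW1 j ω) (hK _) (abs_nonneg _) zero_le_one
      _ = K := one_mul K
  rw [← integral_sub (hint s) (hint s')]
  have := norm_integral_le_of_norm_le_const (μ := P) (C := L / h ^ 3 * |s - s'|)
    (f := fun ω => W j ω * q ((s - T j ω) / h) / h ^ 2 - W j ω * q ((s' - T j ω) / h) / h ^ 2)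
    (ae_of_all _ fun ω => by
      have := abs_kernelAverage_sub_le (n := 1) (w := fun _ => W j ω) (t := fun _ => T j ω)
        hL hh (fun _ => hW1 j ω) s s'
      simpa [kernelAverage] using this)
  simpa using this

/-- A finite grid of mesh `1 / n` reduces the uniform deviation of kernel averages over `[m, M]`
to the pointwise one. -/
theorem measureReal_exists_lt_abs_kernelAverage_sub_le
    (hW : ∀ j, Measurable (W j)) (hT : ∀ j, Measurable (T j)) (hW1 : ∀ j ω, |W j ω| ≤ 1)
    (hind : iIndepFun (fun j ω => (W j ω, T j ω)) P) (hq : Measurable q)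
    {K L : ℝ} (hK : ∀ u, |q u| ≤ K) (hL : ∀ x y, |q x - q y| ≤ L * |x - y|)
    (hq0 : ∀ u, u ∉ Icc (-1 : ℝ) 1 → q u = 0)
    {m M h C a η : ℝ} {e : ℝ → ℝ} (hmM : m ≤ M) (hh : 0 < h)
    (hC : ∀ j, ∀ s ∈ Icc m M, P.real (T j ⁻¹' Icc (s - h) (s + h)) ≤ C * h)
    (ha : 0 ≤ a) (hah : 2 * K * a * h ≤ 1)
    (he : ∀ j s, ∫ ω, W j ω * q ((s - T j ω) / h) / h ^ 2 ∂P = e s) {n : ℕ} (hn : 0 < n)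
    (hη : 2 * (L / h ^ 3 * (1 / n)) ≤ η / 2) :
    P.real {ω | ∃ s ∈ Icc m M,
        η < |kernelAverage q h (fun j => W j ω) (fun j => T j ω) n s - e s|} ≤
      ((M - m) * n + 1) *
        (2 * Real.exp (n * h ^ 3 * (a ^ 2 * (K ^ 2 * C) - a * (η / 2)))) := by
  have hn' : (0 : ℝ) < n := by exact_mod_cast hn
  have hL0 : 0 ≤ L := by
    have := (abs_nonneg _).trans (hL 1 0)
    simpa using this
  set N := ⌊(M - m) * n⌋₊ with hN
  have hNle : (N : ℝ) ≤ (M - m) * n :=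
    Nat.floor_le (mul_nonneg (sub_nonneg.2 hmM) hn'.le)
  have hgrid : ∀ i ∈ Finset.range (N + 1), m + i / n ∈ Icc m M := fun i hi => by
    refine ⟨by simp; positivity, ?_⟩
    have h1 : (i : ℝ) ≤ N := by exact_mod_cast Nat.lt_succ_iff.1 (Finset.mem_range.1 hi)
    have h2 : (i : ℝ) / n ≤ M - m := (div_le_iff₀ hn').2 (h1.trans hNle)
    linarith
  have hsub : {ω | ∃ s ∈ Icc m M,
        η < |kernelAverage q h (fun j => W j ω) (fun j => T j ω) n s - e s|} ⊆
      ⋃ i ∈ Finset.range (N + 1), {ω | η / 2 ≤ |kernelAverage q h (fun j => W j ω)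
        (fun j => T j ω) n (m + i / n) - e (m + i / n)|} := by
    rintro ω ⟨s, hs, hlt⟩
    set i := ⌊(s - m) * n⌋₊ with hi
    have hpos : 0 ≤ (s - m) * n := mul_nonneg (sub_nonneg.2 hs.1) hn'.le
    have hi1 : (i : ℝ) ≤ (s - m) * n := Nat.floor_le hpos
    have hi2 : (s - m) * n < i + 1 := Nat.lt_floor_add_one _
    have hiN : i ∈ Finset.range (N + 1) := by
      refine Finset.mem_range.2 (Nat.lt_succ_of_le (Nat.floor_le_floor ?_))
      exact mul_le_mul_of_nonneg_right (by linarith [hs.2]) hn'.le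
    have hdist : |s - (m + i / n)| ≤ 1 / n := by
      have h1 : (i : ℝ) / n ≤ s - m := (div_le_iff₀ hn').2 hi1
      have h2 : s - m ≤ (i + 1) / n := (le_div_iff₀ hn').2 hi2.le
      rw [add_div] at h2
      rw [abs_le]
      have : 0 < 1 / (n : ℝ) := by positivity
      constructor <;> linarith
    have h1 := abs_kernelAverage_sub_le (n := n) (w := fun j => W j ω) (t := fun j => T j ω)
      hL hh (fun j => hW1 j ω) s (m + i / n)
    -- The expectation is the same for every index, so index 0 serves.
    have h2 := abs_integral_kernel_sub_le (P := P) hW hT hW1 hq hK hL hh s (m + i / n) 0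
    rw [he, he] at h2
    have h3 : L / h ^ 3 * |s - (m + i / n)| ≤ L / h ^ 3 * (1 / n) := by gcongr
    simp only [mem_iUnion, mem_ofPred_eq, exists_prop]
    refine ⟨i, hiN, ?_⟩
    set A := kernelAverage q h (fun j => W j ω) (fun j => T j ω) n
    have htri : |A s - e s| ≤ |A s - A (m + i / n)| + |A (m + i / n) - e (m + i / n)| +
        |e s - e (m + i / n)| := by
      have := abs_sub_le (A s) (A (m + i / n)) (e s)
      have := abs_sub_le (A (m + i / n)) (e (m + i / n)) (e s)
      rw [abs_sub_comm (e (m + i / n)) (e s)] at this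
      linarith
    linarith
  calc _ ≤ P.real (⋃ i ∈ Finset.range (N + 1), {ω | η / 2 ≤ |kernelAverage q h
        (fun j => W j ω) (fun j => T j ω) n (m + i / n) - e (m + i / n)|}) :=
        measureReal_mono hsub (measure_ne_top _ _)
    _ ≤ ∑ i ∈ Finset.range (N + 1), P.real {ω | η / 2 ≤ |kernelAverage q h
        (fun j => W j ω) (fun j => T j ω) n (m + i / n) - e (m + i / n)|} :=
        measureReal_biUnion_finset_le _ _
    _ ≤ ∑ i ∈ Finset.range (N + 1),
        (2 * Real.exp (n * h ^ 3 * (a ^ 2 * (K ^ 2 * C) - a * (η / 2)))) :=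
        Finset.sum_le_sum fun i hi => measureReal_le_abs_kernelAverage_sub_le hW hT hW1 hind hq
          hK hq0 hh (fun j => hC j _ (hgrid i hi)) ha hah (fun j => he j _) hn
    _ ≤ _ := by
        rw [Finset.sum_const, Finset.card_range, nsmul_eq_mul]
        gcongr
        push_cast
        linarith

/-! ### Bandwidth asymptotics and the limit of the deviation bound. -/

theorem tendsto_bandwidth {c α : ℝ} (hα : 0 < α) :
    Tendsto (fun n : ℕ => bandwidth c α n) atTop (𝓝 0) := by
  have := ((tendsto_rpow_neg_atTop hα).comp tendsto_natCast_atTop_atTop).const_mul c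
  simpa [bandwidth] using this

theorem bandwidth_pos {c α : ℝ} (hc : 0 < c) {n : ℕ} (hn : 0 < n) : 0 < bandwidth c α n :=
  mul_pos hc (Real.rpow_pos_of_pos (by exact_mod_cast hn) _)

theorem natCast_mul_bandwidth_pow_three {c α : ℝ} {n : ℕ} (hn : 0 < n) :
    (n : ℝ) * bandwidth c α n ^ 3 = c ^ 3 * (n : ℝ) ^ (1 - 3 * α) := by
  have hn' : (0 : ℝ) < n := by exact_mod_cast hn
  rw [bandwidth, mul_pow, ← Real.rpow_natCast ((n : ℝ) ^ (-α)), ← Real.rpow_mul hn'.le,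
    show (1 - 3 * α) = 1 + (-α) * (3 : ℕ) by push_cast; ring, Real.rpow_add hn', Real.rpow_one]
  ring

theorem tendsto_natCast_mul_bandwidth_pow_three {c α : ℝ} (hc : 0 < c) (hα : α < 1 / 3) :
    Tendsto (fun n : ℕ => (n : ℝ) * bandwidth c α n ^ 3) atTop atTop := by
  have := ((tendsto_rpow_atTop (show 0 < 1 - 3 * α by linarith)).comp
    tendsto_natCast_atTop_atTop).const_mul_atTop (pow_pos hc 3)
  refine this.congr' ?_
  filter_upwards [eventually_gt_atTop 0] with n hn
  rw [natCast_mul_bandwidth_pow_three hn]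
  rfl

theorem tendsto_natCast_mul_exp_neg_bandwidth {c α κ : ℝ} (hc : 0 < c) (hα : α < 1 / 3)
    (hκ : 0 < κ) :
    Tendsto (fun n : ℕ => (n : ℝ) * Real.exp (-κ * (n * bandwidth c α n ^ 3))) atTop (𝓝 0) := by
  have hβ : 0 < 1 - 3 * α := by linarith
  -- In the variable x = n^(1 - 3α) the factor n is x^(1 / (1 - 3α)), so this is a power against an
  -- exponential.
  have h1 := (tendsto_rpow_mul_exp_neg_mul_atTop_nhds_zero (1 / (1 - 3 * α)) (κ * c ^ 3)
    (by positivity)).comp ((tendsto_rpow_atTop hβ).comp tendsto_natCast_atTop_atTop)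
  refine h1.congr' ?_
  filter_upwards [eventually_gt_atTop 0] with n hn
  have hn' : (0 : ℝ) < n := by exact_mod_cast hn
  simp only [Function.comp_apply]
  rw [natCast_mul_bandwidth_pow_three hn, ← Real.rpow_mul hn'.le, mul_one_div_cancel hβ.ne',
    Real.rpow_one]
  ring_nf

/-- Kernel averages with bandwidth `c n ^ (-α)`, `α < 1/3`, normalized as for the derivative of a
kernel density estimator, are uniformly close to their expectations, in probability. -/
theorem tendsto_measureReal_exists_lt_abs_kernelAverage_sub
    (hW : ∀ j, Measurable (W j)) (hT : ∀ j, Measurable (T j)) (hW1 : ∀ j ω, |W j ω| ≤ 1)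
    (hind : iIndepFun (fun j ω => (W j ω, T j ω)) P) (hq : Measurable q)
    {K L : ℝ} (hK : ∀ u, |q u| ≤ K) (hL : ∀ x y, |q x - q y| ≤ L * |x - y|)
    (hq0 : ∀ u, u ∉ Icc (-1 : ℝ) 1 → q u = 0)
    {m M h₀ C η c α : ℝ} {e : ℝ → ℝ → ℝ} (hmM : m ≤ M) (hh₀ : 0 < h₀)
    (hC : ∀ j, ∀ h ∈ Ioc 0 h₀, ∀ s ∈ Icc m M, P.real (T j ⁻¹' Icc (s - h) (s + h)) ≤ C * h)
    (he : ∀ h j s, ∫ ω, W j ω * q ((s - T j ω) / h) / h ^ 2 ∂P = e h s)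
    (hη : 0 < η) (hc : 0 < c) (hα : α ∈ Ioo (0 : ℝ) (1 / 3)) :
    Tendsto (fun n : ℕ => P.real {ω | ∃ s ∈ Icc m M, η < |kernelAverage q (bandwidth c α n)
      (fun j => W j ω) (fun j => T j ω) n s - e (bandwidth c α n) s|}) atTop (𝓝 0) := by
  have hK0 : 0 ≤ K := (abs_nonneg _).trans (hK 0)
  have hC0 : 0 ≤ C := by
    have := measureReal_nonneg.trans (hC 0 h₀ ⟨hh₀, le_rfl⟩ m ⟨le_rfl, hmM⟩)
    exact nonneg_of_mul_nonneg_left this hh₀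
  -- This makes the quadratic term at most a η / 4, half of the linear term a η / 2. The added 1
  -- keeps the denominator positive when K or C is zero.
  set a := η / (4 * (K ^ 2 * C + 1)) with ha
  have ha0 : 0 < a := by positivity
  have haη : a ^ 2 * (K ^ 2 * C) - a * (η / 2) ≤ -(a * η / 4) := by
    have h1 : a * (K ^ 2 * C + 1) = η / 4 := by
      rw [ha]; field_simp
    have h2 : a ^ 2 * (K ^ 2 * C) ≤ a * (η / 4) := by
      rw [← h1]; nlinarith
    linarith
  set κ := a * η / 4 with hκ
  have hκ0 : 0 < κ := by positivity
  have hbw := tendsto_bandwidth (c := c) hα.1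
  have hev1 : ∀ᶠ n : ℕ in atTop, bandwidth c α n < h₀ := hbw.eventually_lt_const hh₀
  have hev2 : ∀ᶠ n : ℕ in atTop, 2 * K * a * bandwidth c α n < 1 := by
    have := hbw.const_mul (2 * K * a)
    rw [mul_zero] at this
    exact this.eventually_lt_const one_pos
  have hev3 : ∀ᶠ n : ℕ in atTop, 2 * (L / bandwidth c α n ^ 3 * (1 / n)) ≤ η / 2 := by
    have h1 := (tendsto_natCast_mul_bandwidth_pow_three hc hα.2).inv_tendsto_atTop.const_mul
      (2 * L)
    rw [mul_zero] at h1
    filter_upwards [h1.eventually_lt_const (half_pos hη), eventually_gt_atTop 0] with n hn hn0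
    refine le_trans (le_of_eq ?_) hn.le
    have := (bandwidth_pos (α := α) hc hn0).ne'
    simp only [Pi.inv_apply]
    field_simp
  have hexp : Tendsto (fun n : ℕ => Real.exp (-κ * (n * bandwidth c α n ^ 3))) atTop (𝓝 0) :=
    Real.tendsto_exp_atBot.comp
      ((tendsto_natCast_mul_bandwidth_pow_three hc hα.2).const_mul_atTop_of_neg (neg_lt_zero.2 hκ0))
  have hlim := ((tendsto_natCast_mul_exp_neg_bandwidth hc hα.2 hκ0).const_mul
    (2 * (M - m))).add (hexp.const_mul 2)
  rw [mul_zero, mul_zero, add_zero] at hlim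
  refine squeeze_zero' (Eventually.of_forall fun _ => measureReal_nonneg) ?_ hlim
  filter_upwards [hev1, hev2, hev3, eventually_gt_atTop 0] with n h1 h2 h3 hn
  have hh := bandwidth_pos (α := α) hc hn
  refine (measureReal_exists_lt_abs_kernelAverage_sub_le hW hT hW1 hind hq hK hL hq0 hmM hh
    (fun j s hs => hC j _ ⟨hh, h1.le⟩ s hs) ha0.le h2.le (he _) hn h3).trans ?_
  have hM0 : 0 ≤ M - m := sub_nonneg.2 hmM
  calc _ ≤ ((M - m) * n + 1) * (2 * Real.exp (-κ * (n * bandwidth c α n ^ 3))) := by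
        refine mul_le_mul_of_nonneg_left (mul_le_mul_of_nonneg_left (Real.exp_le_exp.2 ?_)
          zero_le_two) (by positivity)
        exact (mul_le_mul_of_nonneg_left haη (by positivity)).trans_eq (by ring)
    _ = _ := by ring

end Deviation

/-! ### Consequences of density bounds, and differentiation of smoothed integrals. -/

/-- The jump at a point is the mass of that point, which is zero. -/
theorem continuous_cdf {μ : Measure ℝ} [IsProbabilityMeasure μ] [NullSingletonClass μ] :
    Continuous (cdf μ) := by
  refine continuous_iff_continuousAt.2 fun x => ?_
  rw [(monotone_cdf μ).continuousAt_iff_leftLim_eq_rightLim, StieltjesFunction.rightLim_eq]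
  have h1 : (cdf μ).measure {x} = 0 := by rw [measure_cdf, measure_singleton]
  rw [StieltjesFunction.measure_singleton, ENNReal.ofReal_eq_zero] at h1
  exact le_antisymm ((monotone_cdf μ).leftLim_le le_rfl) (by linarith)

/-- A pointwise lower bound on the density replaces differentiability of the distribution function,
which would need a continuous density. -/
theorem mul_sub_le_cdf_sub {μ : Measure ℝ} [IsProbabilityMeasure μ] {f : ℝ → ℝ}
    (hμ : μ = volume.withDensity fun x => ENNReal.ofReal (f x)) {ε a b x y : ℝ}
    (hε : 0 ≤ ε) (hf : ∀ x ∈ Icc a b, ε ≤ f x) (hx : a ≤ x) (hy : y ≤ b) (hxy : x ≤ y) :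
    ε * (y - x) ≤ cdf μ y - cdf μ x := by
  have h1 : ENNReal.ofReal (cdf μ y - cdf μ x) = μ (Ioc x y) := by
    conv_rhs => rw [← measure_cdf μ]
    rw [StieltjesFunction.measure_Ioc]
  have h2 : ENNReal.ofReal (ε * (y - x)) ≤ μ (Ioc x y) := by
    rw [hμ, withDensity_apply _ measurableSet_Ioc]
    calc ENNReal.ofReal (ε * (y - x)) = ∫⁻ _ in Ioc x y, ENNReal.ofReal ε := by
          rw [setLIntegral_const, Real.volume_Ioc, ← ENNReal.ofReal_mul hε]
      _ ≤ _ := setLIntegral_mono' measurableSet_Ioc fun z hz =>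
          ENNReal.ofReal_le_ofReal (hf z ⟨hx.trans hz.1.le, hz.2.trans hy⟩)
  rw [← h1] at h2
  exact (ENNReal.ofReal_le_ofReal_iff (sub_nonneg.2 (monotone_cdf μ hxy))).1 h2

theorem measureReal_Icc_le_of_density_le {μ : Measure ℝ} [IsFiniteMeasure μ] {f : ℝ → ℝ}
    (hμ : μ = volume.withDensity fun x => ENNReal.ofReal (f x)) {C a b x y : ℝ}
    (hC : 0 ≤ C) (hf : ∀ x ∈ Icc a b, f x ≤ C) (hx : a ≤ x) (hy : y ≤ b) (hxy : x ≤ y) :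
    μ.real (Icc x y) ≤ C * (y - x) := by
  refine ENNReal.toReal_le_of_le_ofReal (mul_nonneg hC (sub_nonneg.2 hxy)) ?_
  rw [hμ, withDensity_apply _ measurableSet_Icc]
  calc ∫⁻ z in Icc x y, ENNReal.ofReal (f z) ≤ ∫⁻ _ in Icc x y, ENNReal.ofReal C :=
        setLIntegral_mono' measurableSet_Icc fun z hz =>
          ENNReal.ofReal_le_ofReal (hf z ⟨hx.trans hz.1, hz.2.trans hy⟩)
    _ = _ := by rw [setLIntegral_const, Real.volume_Icc, ← ENNReal.ofReal_mul hC]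

section Density

variable {G : Measure ℝ} {g : ℝ → ℝ}

theorem integral_eq_integral_mul_density (hgm : Measurable g) (hg0 : ∀ t, 0 ≤ g t)
    (hG : G = volume.withDensity fun t => ENNReal.ofReal (g t)) (φ : ℝ → ℝ) :
    ∫ u, φ u ∂G = ∫ u, g u * φ u := by
  rw [hG, integral_withDensity_eq_integral_toReal_smul (by fun_prop)
    (ae_of_all _ fun _ => ENNReal.ofReal_lt_top)]
  simp [hg0]

theorem integrable_density_mul (hgm : Measurable g) (hg0 : ∀ t, 0 ≤ g t)
    (hG : G = volume.withDensity fun t => ENNReal.ofReal (g t)) {φ : ℝ → ℝ}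
    (hφ : Integrable φ G) : Integrable (fun u => g u * φ u) := by
  rw [hG, integrable_withDensity_iff_integrable_smul' (by fun_prop)
    (ae_of_all _ fun _ => ENNReal.ofReal_lt_top)] at hφ
  simpa [hg0] using hφ

end Density

theorem hasDerivAt_integral_kernel {μ : Measure ℝ} [IsFiniteMeasure μ] {k w : ℝ → ℝ}
    (hk : ContDiff ℝ 1 k) (hw : Measurable w) {A K K' : ℝ} (hA : ∀ u, |w u| ≤ A)
    (hK : ∀ u, |k u| ≤ K) (hK' : ∀ u, |deriv k u| ≤ K') {h : ℝ} (hh : 0 < h) (s : ℝ) :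
    HasDerivAt (fun s => ∫ u, w u * k ((s - u) / h) / h ∂μ)
      (∫ u, w u * deriv k ((s - u) / h) / h ^ 2 ∂μ) s := by
  have hkc : Continuous k := hk.continuous
  have hdc : Continuous (deriv k) := hk.continuous_deriv le_rfl
  have hA0 : 0 ≤ A := (abs_nonneg _).trans (hA 0)
  have hmeas : ∀ r, AEStronglyMeasurable (fun u => w u * k ((r - u) / h) / h) μ := fun r =>
    ((hw.mul (by fun_prop)).div_const _).aestronglyMeasurable
  refine (hasDerivAt_integral_of_dominated_loc_of_deriv_le (s := univ)
    (F' := fun s u => w u * deriv k ((s - u) / h) / h ^ 2)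
    (bound := fun _ => A * K' / h ^ 2) univ_mem
    (Eventually.of_forall hmeas) ?_ ?_ ?_ (integrable_const _) ?_).2
  · refine Integrable.of_bound (hmeas s) (A * K / h) (ae_of_all _ fun u => ?_)
    rw [Real.norm_eq_abs, abs_div, abs_mul, abs_of_pos hh]
    gcongr
    exacts [hA u, hK _]
  · exact ((hw.mul (by fun_prop)).div_const _).aestronglyMeasurable
  · refine ae_of_all _ fun u r _ => ?_
    rw [Real.norm_eq_abs, abs_div, abs_mul, abs_of_pos (pow_pos hh 2)]
    gcongr
    exacts [hA u, hK' _]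
  · refine ae_of_all _ fun u r _ => ?_
    have h1 : HasDerivAt (fun r => (r - u) / h) (1 / h) r :=
      ((hasDerivAt_id r).sub_const u).div_const h
    have h2 := ((((hk.differentiable one_ne_zero) _).hasDerivAt.comp r h1).const_mul
      (w u)).div_const h
    exact h2.congr_deriv (by field_simp)

/-- A function that grows at least at rate `c` to the right of a point has derivative at least `c`
there. -/
theorem le_of_hasDerivAt_of_mul_sub_le {φ : ℝ → ℝ} {φ' c t r : ℝ} (hφ : HasDerivAt φ φ' t)
    (hr : 0 < r) (h : ∀ s ∈ Ioo t (t + r), c * (s - t) ≤ φ s - φ t) : c ≤ φ' := by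
  have h1 := (hasDerivWithinAt_iff_tendsto_slope' (by simp)).1
    (hφ.hasDerivWithinAt (s := Ioi t))
  refine ge_of_tendsto h1 ?_
  filter_upwards [Ioo_mem_nhdsGT (show t < t + r by linarith)] with s hs
  rw [slope_def_field]
  exact (le_div_iff₀ (sub_pos.2 hs.1)).2 (h s hs)

theorem integral_scaledKernel {k : ℝ → ℝ} (hk1 : ∫ u, k u = 1) {h : ℝ} (hh : 0 < h) :
    ∫ v, k (v / h) / h = 1 := by
  rw [integral_div, Measure.integral_comp_div, hk1, abs_of_pos hh, smul_eq_mul, mul_one,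
    div_self hh.ne']

/-! ### Population counterparts: smoothing F and g with the kernel. -/

section Smoothing

variable {G : Measure ℝ} [IsProbabilityMeasure G] {g k F : ℝ → ℝ} {M₀ : ℝ}

/-- The derivative of the smoothed `(F - λ) g` inherits a lower bound from the increments of `F`,
when `λ` is close to the values of `F` nearby. -/
theorem le_integral_sub_mul_deriv_kernel (hgm : Measurable g) (hg0 : ∀ t, 0 ≤ g t)
    (hG : G = volume.withDensity fun t => ENNReal.ofReal (g t))
    (hk : ContDiff ℝ 1 k) (hknn : ∀ u, 0 ≤ k u) (hk1 : ∫ u, k u = 1)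
    (hk0 : ∀ u, u ∉ Icc (-1 : ℝ) 1 → k u = 0) (hkc : HasCompactSupport k)
    (hF : Measurable F) {A : ℝ} (hFA : ∀ u, |F u| ≤ A)
    {ε₁ ε₂ B δ l h t : ℝ} (hε₁ : 0 ≤ ε₁)
    (hFinc : ∀ x ∈ Icc 0 M₀, ∀ y ∈ Icc 0 M₀, x ≤ y → ε₁ * (y - x) ≤ F y - F x)
    (hg : ∀ x ∈ Icc 0 M₀, ε₂ ≤ g x)
    (hgL : ∀ x ∈ Icc 0 M₀, ∀ y ∈ Icc 0 M₀, |g y - g x| ≤ B * |y - x|)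
    (hh : 0 < h) (ht0 : 0 ≤ t - h) (htM : t + 2 * h ≤ M₀)
    (hδ : ∀ x ∈ Icc (t - h) (t + h), |F x - l| ≤ δ) :
    ε₁ * ε₂ - δ * B ≤ ∫ u, (F u - l) * deriv k ((t - u) / h) / h ^ 2 ∂G := by
  obtain ⟨K, hK⟩ := hk.continuous.bounded_above_of_compact_support hkc
  obtain ⟨K', hK'⟩ := (hk.continuous_deriv le_rfl).bounded_above_of_compact_support hkc.deriv
  have hwA : ∀ u, |F u - l| ≤ A + |l| := fun u => (abs_sub _ _).trans (by linarith [hFA u])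
  have hkcont := hk.continuous
  have hδ0 : 0 ≤ δ := (abs_nonneg _).trans (hδ t ⟨by linarith, by linarith⟩)
  refine le_of_hasDerivAt_of_mul_sub_le
    (hasDerivAt_integral_kernel hk (hF.sub_const l) hwA hK hK' hh t) hh fun s hs => ?_
  set ψ : ℝ → ℝ := fun x => (F x - l) * g x with hψ
  have hGint : ∀ r, Integrable (fun u => (F u - l) * k ((r - u) / h) / h) G := fun r => by
    refine Integrable.of_bound (C := (A + |l|) * K / h)
      (((hF.sub_const l).mul (by fun_prop)).div_const _).aestronglyMeasurable
      (ae_of_all _ fun u => ?_)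
    rw [Real.norm_eq_abs, abs_div, abs_mul, abs_of_pos hh]
    have := (abs_nonneg _).trans (hwA u)
    gcongr
    exacts [hwA u, hK _]
  -- The substitution u = r - v moves the dependence on r from the kernel to ψ, so increments in r
  -- become kernel-weighted increments of (F - l) g.
  have hrep : ∀ r, ∫ u, (F u - l) * k ((r - u) / h) / h ∂G =
      ∫ v, k (v / h) / h * ψ (r - v) := fun r => by
    rw [integral_eq_integral_mul_density hgm hg0 hG,
      ← integral_sub_left_eq_self (fun u => g u * ((F u - l) * k ((r - u) / h) / h)) volume r]
    refine integral_congr_ae (ae_of_all _ fun v => ?_)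
    simp only [hψ, sub_sub_cancel]
    ring
  have hint : ∀ r, Integrable (fun v => k (v / h) / h * ψ (r - v)) := fun r => by
    refine ((integrable_density_mul hgm hg0 hG (hGint r)).comp_sub_left r).congr
      (ae_of_all _ fun v => ?_)
    simp only [hψ, sub_sub_cancel]
    ring
  have hkint : Integrable (fun v => k (v / h) / h) := by
    refine Integrable.div_const ?_ h
    exact (hkcont.integrable_of_hasCompactSupport hkc).comp_div hh.ne'
  have hbound : ∀ v, (ε₁ * ε₂ - δ * B) * (s - t) * (k (v / h) / h) ≤
      k (v / h) / h * ψ (s - v) - k (v / h) / h * ψ (t - v) := fun v => by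
    by_cases hv : v / h ∈ Icc (-1 : ℝ) 1
    · have hv1 : v ≤ h := by have := (div_le_iff₀ hh).1 hv.2; linarith
      have hv2 : -h ≤ v := by have := (le_div_iff₀ hh).1 hv.1; linarith
      have hx : t - v ∈ Icc 0 M₀ := ⟨by linarith, by linarith⟩
      -- Here s < t + h and v ≥ -h, which is why room of 2h to the right of t is needed.
      have hy : s - v ∈ Icc 0 M₀ := ⟨by linarith [hs.1], by linarith [hs.2]⟩
      have hst : 0 < s - t := sub_pos.2 hs.1
      have h1 := hFinc _ hx _ hy (by linarith)
      have h2 := hg _ hy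
      have h3 := hgL _ hx _ hy
      have h4 := hδ (t - v) ⟨by linarith, by linarith⟩
      rw [show s - v - (t - v) = s - t by ring] at h1 h3
      rw [abs_of_pos hst] at h3
      -- Product rule for increments: ψ(s - v) - ψ(t - v) splits into the increment of F times g(s -
      -- v), bounded below here, and F(t - v) - l times the increment of g, bounded next.
      have h5 : ε₁ * ε₂ * (s - t) ≤ (F (s - v) - F (t - v)) * g (s - v) := by
        have : 0 ≤ ε₁ * (s - t) := mul_nonneg hε₁ hst.le
        calc ε₁ * ε₂ * (s - t) = ε₁ * (s - t) * ε₂ := by ring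
          _ ≤ ε₁ * (s - t) * g (s - v) := by gcongr
          _ ≤ _ := mul_le_mul_of_nonneg_right h1 (hg0 _)
      have h6 : |(F (t - v) - l) * (g (s - v) - g (t - v))| ≤ δ * (B * (s - t)) := by
        rw [abs_mul]
        exact mul_le_mul h4 h3 (abs_nonneg _) hδ0
      have h7 := (abs_le.1 h6).1
      have h8 : (ε₁ * ε₂ - δ * B) * (s - t) ≤ ψ (s - v) - ψ (t - v) := by
        simp only [hψ]
        linarith
      rw [← mul_sub, mul_comm]
      exact mul_le_mul_of_nonneg_left h8 (div_nonneg (hknn _) hh.le)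
    · simp [hk0 _ hv]
  rw [hrep, hrep, ← integral_sub (hint s) (hint t)]
  calc _ = ∫ v, (ε₁ * ε₂ - δ * B) * (s - t) * (k (v / h) / h) := by
        rw [integral_const_mul, integral_scaledKernel hk1 hh, mul_one]
    _ ≤ _ := integral_mono (hkint.const_mul _) ((hint s).sub (hint t)) hbound

theorem le_integral_kernel (hgm : Measurable g) (hg0 : ∀ t, 0 ≤ g t)
    (hG : G = volume.withDensity fun t => ENNReal.ofReal (g t))
    (hk : Continuous k) (hknn : ∀ u, 0 ≤ k u) (hk1 : ∫ u, k u = 1)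
    (hk0 : ∀ u, u ∉ Icc (-1 : ℝ) 1 → k u = 0) (hkc : HasCompactSupport k)
    {ε h t : ℝ} (hg : ∀ x ∈ Icc 0 M₀, ε ≤ g x)
    (hh : 0 < h) (ht0 : 0 ≤ t - h) (htM : t + h ≤ M₀) :
    ε ≤ ∫ u, k ((t - u) / h) / h ∂G := by
  obtain ⟨K, hK⟩ := hk.bounded_above_of_compact_support hkc
  have hGint : Integrable (fun u => k ((t - u) / h) / h) G := by
    refine Integrable.of_bound (C := K / h) (by fun_prop) (ae_of_all _ fun u => ?_)
    rw [norm_div, Real.norm_of_nonneg hh.le]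
    gcongr
    exact hK _
  have hkint : Integrable (fun v => k (v / h) / h) := by
    refine Integrable.div_const ?_ h
    exact (hk.integrable_of_hasCompactSupport hkc).comp_div hh.ne'
  have h1 := integral_scaledKernel hk1 hh
  rw [← integral_sub_left_eq_self (fun v => k (v / h) / h) volume t] at h1
  rw [integral_eq_integral_mul_density hgm hg0 hG]
  calc ε = ∫ u, ε * (k ((t - u) / h) / h) := by rw [integral_const_mul, h1, mul_one]
    _ ≤ _ := integral_mono ((hkint.comp_sub_left t).const_mul ε)
      (integrable_density_mul hgm hg0 hG hGint) fun u => ?_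
  by_cases hv : (t - u) / h ∈ Icc (-1 : ℝ) 1
  · have hv1 : t - u ≤ h := by have := (div_le_iff₀ hh).1 hv.2; linarith
    have hv2 : -h ≤ t - u := by have := (le_div_iff₀ hh).1 hv.1; linarith
    exact mul_le_mul_of_nonneg_right (hg u ⟨by linarith, by linarith⟩)
      (div_nonneg (hknn _) hh.le)
  · simp [hk0 _ hv]

theorem abs_integral_mul_kernel_sub_le {μ : Measure ℝ} [IsFiniteMeasure μ]
    (hk : Continuous k) (hknn : ∀ u, 0 ≤ k u)
    (hk0 : ∀ u, u ∉ Icc (-1 : ℝ) 1 → k u = 0) (hkc : HasCompactSupport k)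
    (hF : Measurable F) {A : ℝ} (hFA : ∀ u, |F u| ≤ A) {ρ h t : ℝ} (hh : 0 < h)
    (hρ : ∀ x ∈ Icc (t - h) (t + h), |F x - F t| ≤ ρ) :
    |(∫ u, F u * k ((t - u) / h) / h ∂μ) - F t * ∫ u, k ((t - u) / h) / h ∂μ| ≤
      ρ * ∫ u, k ((t - u) / h) / h ∂μ := by
  obtain ⟨K, hK⟩ := hk.bounded_above_of_compact_support hkc
  have hint : Integrable (fun u => k ((t - u) / h) / h) μ := by
    refine Integrable.of_bound (C := K / h) (by fun_prop) (ae_of_all _ fun u => ?_)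
    rw [norm_div, Real.norm_of_nonneg hh.le]
    gcongr
    exact hK _
  have hint' : Integrable (fun u => F u * k ((t - u) / h) / h) μ := by
    simp_rw [mul_div_assoc]
    exact hint.bdd_mul hF.aestronglyMeasurable (ae_of_all _ hFA)
  rw [← integral_const_mul, ← integral_sub hint' (hint.const_mul _), ← integral_const_mul]
  refine norm_integral_le_of_norm_le (f := fun u => F u * k ((t - u) / h) / h -
    F t * (k ((t - u) / h) / h)) (hint.const_mul ρ) (ae_of_all _ fun u => ?_)
  rw [show F u * k ((t - u) / h) / h - F t * (k ((t - u) / h) / h) =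
    (F u - F t) * (k ((t - u) / h) / h) by ring, norm_mul,
    Real.norm_of_nonneg (div_nonneg (hknn _) hh.le)]
  by_cases hv : (t - u) / h ∈ Icc (-1 : ℝ) 1
  · have hv1 : t - u ≤ h := by have := (div_le_iff₀ hh).1 hv.2; linarith
    have hv2 : -h ≤ t - u := by have := (le_div_iff₀ hh).1 hv.1; linarith
    exact mul_le_mul_of_nonneg_right (hρ u ⟨by linarith, by linarith⟩)
      (div_nonneg (hknn _) hh.le)
  · simp [hk0 _ hv]

end Smoothing

/-! ### Monotonicity and stability of quotients. -/

/-- The quotient rule with one factor D divided out. In this form the condition is linear in (N',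
D') once N / D is regarded as a constant. -/
theorem monotoneOn_div_of_hasDerivAt {N D N' D' : ℝ → ℝ} {m M : ℝ}
    (hN : ∀ t ∈ Icc m M, HasDerivAt N (N' t) t) (hD : ∀ t ∈ Icc m M, HasDerivAt D (D' t) t)
    (hpos : ∀ t ∈ Icc m M, 0 < D t) (h : ∀ t ∈ Icc m M, 0 ≤ N' t - N t / D t * D' t) :
    MonotoneOn (fun t => N t / D t) (Icc m M) := by
  have hd : ∀ t ∈ Icc m M, HasDerivAt (fun t => N t / D t)
      ((N' t * D t - N t * D' t) / D t ^ 2) t := fun t ht =>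
    (hN t ht).fun_div (hD t ht) (hpos t ht).ne'
  refine monotoneOn_of_deriv_nonneg (convex_Icc m M)
    (fun t ht => (hd t ht).continuousAt.continuousWithinAt)
    (fun t ht => (hd t (interior_subset ht)).differentiableAt.differentiableWithinAt)
    fun t ht => ?_
  have ht' := interior_subset ht
  rw [(hd t ht').deriv]
  have h1 := hpos t ht'
  have h2 := mul_nonneg (h t ht') h1.le
  refine div_nonneg (h2.trans_eq ?_) (sq_nonneg _)
  field_simp

/-- The quotient of two perturbed quantities `p₁ ≈ x p` and `p` is close to `x`. -/
theorem abs_div_sub_le_of_abs_sub_le {x p p₁ N D ρ η ε : ℝ} (hx0 : 0 ≤ x) (hx1 : x ≤ 1)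
    (hε : 0 < ε) (hp : ε ≤ p) (hη : η ≤ ε / 2) (hρ : |p₁ - x * p| ≤ ρ * p)
    (hN : |N - p₁| ≤ η) (hD : |D - p| ≤ η) :
    0 < D ∧ |N / D - x| ≤ 2 * ρ + 4 * η / ε := by
  have hD' := abs_le.1 hD
  have hDpos : 0 < D := by linarith
  have hp0 : 0 < p := hε.trans_le hp
  have hη0 : 0 ≤ η := (abs_nonneg _).trans hN
  have hρ0 : 0 ≤ ρ := nonneg_of_mul_nonneg_left ((abs_nonneg _).trans hρ) hp0
  refine ⟨hDpos, ?_⟩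
  have h1 : |N - x * D| ≤ ρ * p + 2 * η := by
    have h2 : |x * (D - p)| ≤ η := by
      rw [abs_mul, abs_of_nonneg hx0]
      calc x * |D - p| ≤ 1 * η := mul_le_mul hx1 hD (abs_nonneg _) zero_le_one
        _ = η := one_mul η
    have hρ' := abs_le.1 hρ
    have hN' := abs_le.1 hN
    have h2' := abs_le.1 h2
    rw [abs_le]
    constructor <;> nlinarith
  rw [show N / D - x = (N - x * D) / D by field_simp, abs_div, abs_of_pos hDpos,
    div_le_iff₀ hDpos]
  -- Since |D - p| ≤ ε / 2 and p ≥ ε, both p ≤ 2D and D ≥ ε / 2 hold; these two bounds produce the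
  -- factors 2 and 4.
  have h3 : ρ * p ≤ ρ * (2 * D) := by gcongr; linarith
  have h4 : 2 * η ≤ 4 * η / ε * D := by
    rw [div_mul_eq_mul_div, le_div_iff₀ hε]
    nlinarith
  linarith

/-! ### The estimators as kernel averages. -/

/-- For h < s the uncorrected kernel is in force; the factor h compensates for the normalization by
h², which is tailored to the derivative. -/
theorem gHatSub_eq_kernelAverage {k : ℝ → ℝ} {h s : ℝ} (hh : 0 < h) (hs : h < s)
    (x t : ℕ → ℝ) (n : ℕ) (i : Fin 2) :
    gHatSub k h x t n i s =
      h * kernelAverage k h (fun j => if currentStatus (x j) (t j) = i then 1 else 0) t n s := by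
  simp only [gHatSub, kernelEstimator, if_neg (not_le.2 hs), integral_empiricalSub, kernelAverage,
    scaledKernel]
  rw [mul_left_comm]
  congr 1
  rw [Finset.mul_sum]
  refine Finset.sum_congr rfl fun j _ => ?_
  split_ifs
  · field_simp
  · simp

theorem gHatSub_one_eq_kernelAverage {k : ℝ → ℝ} {h s : ℝ} (hh : 0 < h) (hs : h < s)
    (x t : ℕ → ℝ) (n : ℕ) :
    gHatSub k h x t n 1 s =
      h * kernelAverage k h (fun j => if x j ≤ t j then 1 else 0) t n s := by
  rw [gHatSub_eq_kernelAverage hh hs]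
  congr 3
  funext j
  by_cases hj : x j ≤ t j <;> simp [currentStatus, hj]

theorem gHat_eq_kernelAverage {k : ℝ → ℝ} {h s : ℝ} (hh : 0 < h) (hs : h < s)
    (x t : ℕ → ℝ) (n : ℕ) :
    gHat k h x t n s = h * kernelAverage k h (fun _ => 1) t n s := by
  rw [gHat, gHatSub_eq_kernelAverage hh hs, gHatSub_eq_kernelAverage hh hs, ← mul_add]
  unfold kernelAverage
  rw [← mul_add, ← Finset.sum_add_distrib]
  congr 2
  refine Finset.sum_congr rfl fun j _ => ?_
  by_cases hj : x j ≤ t j <;> simp [currentStatus, hj]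

theorem hasDerivAt_mul_kernelAverage {k : ℝ → ℝ} (hk : Differentiable ℝ k) {h : ℝ} (hh : 0 < h)
    (w t : ℕ → ℝ) (n : ℕ) (s : ℝ) :
    HasDerivAt (fun s => h * kernelAverage k h w t n s) (kernelAverage (deriv k) h w t n s) s := by
  have h1 : ∀ j, HasDerivAt (fun s => w j * k ((s - t j) / h) / h ^ 2)
      (w j * (deriv k ((s - t j) / h) * (1 / h)) / h ^ 2) s := fun j =>
    (((hk _).hasDerivAt.comp s (((hasDerivAt_id s).sub_const (t j)).div_const h)).const_mul
      (w j)).div_const _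
  have h2 := ((HasDerivAt.fun_sum (u := Finset.range n) fun j _ => h1 j).const_mul
    (n : ℝ)⁻¹).const_mul h
  refine h2.congr_deriv ?_
  rw [kernelAverage, mul_left_comm, Finset.mul_sum]
  congr 1
  refine Finset.sum_congr rfl fun j _ => ?_
  field_simp

/-! ### Kernel averages in the current status model. -/

section Model

variable {Ω : Type*} [MeasurableSpace Ω] {P : Measure Ω} [IsProbabilityMeasure P]
  {F₀ G : Measure ℝ} {X T : ℕ → Ω → ℝ}

theorem IsCurrentStatusModel.map_prodMk (hXT : IsCurrentStatusModel P F₀ G X T) (j : ℕ) :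
    P.map (fun ω => (X j ω, T j ω)) = F₀.prod G := by
  have hpair : IndepFun (X j) (T j) P :=
    hXT.indep_X_T.comp (measurable_pi_apply j) (measurable_pi_apply j)
  rw [(indepFun_iff_map_prod_eq_prod_map_map (hXT.measurable_X j).aemeasurable
    (hXT.measurable_T j).aemeasurable).1 hpair, hXT.law_X, hXT.law_T]

variable [IsProbabilityMeasure F₀] [IsProbabilityMeasure G]

/-- Fubini for the product law of (X, T): integrating out X first replaces the indicator weight by
the distribution function F₀. -/
theorem IsCurrentStatusModel.integral_mul (hXT : IsCurrentStatusModel P F₀ G X T)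
    {f : ℝ × ℝ → ℝ} (hf : Measurable f) (hf1 : ∀ p, |f p| ≤ 1) {φ : ℝ → ℝ} (hφ : Measurable φ)
    {K : ℝ} (hK : ∀ u, |φ u| ≤ K) (j : ℕ) :
    ∫ ω, f (X j ω, T j ω) * φ (T j ω) ∂P = ∫ u, (∫ x, f (x, u) ∂F₀) * φ u ∂G := by
  have hm : Measurable fun p : ℝ × ℝ => f p * φ p.2 := hf.mul (hφ.comp measurable_snd)
  have h1 := integral_map (μ := P)
    ((hXT.measurable_X j).prodMk (hXT.measurable_T j)).aemeasurable
    (f := fun p : ℝ × ℝ => f p * φ p.2) hm.aestronglyMeasurable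
  rw [← h1, hXT.map_prodMk, integral_prod_symm]
  · simp_rw [integral_mul_const]
  · refine Integrable.of_bound (C := 1 * K) hm.aestronglyMeasurable (ae_of_all _ fun p => ?_)
    rw [norm_mul]
    exact mul_le_mul (hf1 p) (hK _) (abs_nonneg _) zero_le_one

/-- Uniform consistency of weighted kernel averages in the current status model. -/
theorem IsCurrentStatusModel.tendsto_measureReal_exists_lt_abs_sub
    (hXT : IsCurrentStatusModel P F₀ G X T) {g : ℝ → ℝ} {M₀ : ℝ} (hG : CensoringCondition G g M₀)
    {f : ℝ × ℝ → ℝ} (hf : Measurable f) (hf1 : ∀ p, |f p| ≤ 1)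
    {q : ℝ → ℝ} (hq : ContDiff ℝ 1 q) (hqs : tsupport q ⊆ Icc (-1) 1)
    {m M η c α : ℝ} (hm : 0 < m) (hmM : m ≤ M) (hM : M < M₀)
    (hη : 0 < η) (hc : 0 < c) (hα : α ∈ Ioo (0 : ℝ) (1 / 3)) :
    Tendsto (fun n : ℕ => P.real {ω | ∃ s ∈ Icc m M, η < |kernelAverage q (bandwidth c α n)
      (fun j => f (X j ω, T j ω)) (fun j => T j ω) n s -
      ∫ u, (∫ x, f (x, u) ∂F₀) * q ((s - u) / bandwidth c α n) / bandwidth c α n ^ 2 ∂G|})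
      atTop (𝓝 0) := by
  have hqc : HasCompactSupport q := isCompact_Icc.of_isClosed_subset (isClosed_tsupport q) hqs
  obtain ⟨K, hK⟩ := hq.continuous.bounded_above_of_compact_support hqc
  obtain ⟨L, hL⟩ := hq.lipschitzWith_of_hasCompactSupport hqc one_ne_zero
  obtain ⟨C, hC⟩ := isCompact_Icc.exists_bound_of_continuousOn hG.differentiableOn.continuousOn
  have hC0 : 0 ≤ C := (norm_nonneg _).trans (hC 0 ⟨le_rfl, by linarith⟩)
  have hmeas : ∀ j, Measurable fun ω => (X j ω, T j ω) := fun j =>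
    (hXT.measurable_X j).prodMk (hXT.measurable_T j)
  have hind : iIndepFun (fun j ω => (f (X j ω, T j ω), T j ω)) P :=
    (iIndepFun.prodMk_of_indepFun hXT.measurable_X hXT.measurable_T hXT.indep_X hXT.indep_T
      hXT.indep_X_T).comp (fun _ p => (f p, p.2)) fun _ => hf.prodMk measurable_snd
  -- With h at most `min m (M₀ - M)` every window stays in `[0, M₀]`, where g is bounded by C; the
  -- window has length 2h, hence the constant 2C.
  refine tendsto_measureReal_exists_lt_abs_kernelAverage_sub (C := 2 * C) (K := K) (L := L)
    (h₀ := min m (M₀ - M))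
    (e := fun h s => ∫ u, (∫ x, f (x, u) ∂F₀) * q ((s - u) / h) / h ^ 2 ∂G)
    (fun j => hf.comp (hmeas j)) hXT.measurable_T (fun j ω => hf1 _) hind hq.continuous.measurable
    hK (fun x y => ?_) (fun u hu => ?_) hmM (lt_min hm (sub_pos.2 hM)) ?_ ?_ hη hc hα
  · simpa [Real.dist_eq] using hL.dist_le_mul x y
  · exact image_eq_zero_of_notMem_tsupport fun h => hu (hqs h)
  · intro j h hh s hs
    have h1 := (le_min_iff.1 hh.2).1
    have h2 := (le_min_iff.1 hh.2).2
    have h3 : P.real (T j ⁻¹' Icc (s - h) (s + h)) = G.real (Icc (s - h) (s + h)) := by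
      rw [← hXT.law_T j, map_measureReal_apply (hXT.measurable_T j) measurableSet_Icc]
    rw [h3]
    refine (measureReal_Icc_le_of_density_le hG.eq_withDensity hC0
      (fun x hx => (le_abs_self _).trans (hC x hx)) (by linarith [hs.1]) (by linarith [hs.2])
      (by linarith [hh.1])).trans_eq (by ring)
  · intro h j s
    simp_rw [mul_div_assoc]
    refine hXT.integral_mul hf hf1 (φ := fun u => q ((s - u) / h) / h ^ 2)
      (by have := hq.continuous; fun_prop) (K := K / |h ^ 2|) (fun u => ?_) j
    rw [abs_div]
    gcongr
    exact hK _

end Model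

/-! ### From uniform closeness to monotonicity, and the probability limit. -/

theorem integral_ite_le {μ : Measure ℝ} [IsProbabilityMeasure μ] (u : ℝ) :
    ∫ x, (if x ≤ u then (1 : ℝ) else 0) ∂μ = cdf μ u := by
  rw [cdf_eq_real, ← integral_indicator_one measurableSet_Iic]
  rfl

/-- When the kernel averages and their derivatives are uniformly close to their expectations, the
denominator of the naive estimator is positive and the estimator is monotone. -/
theorem pos_and_monotoneOn_naiveEstimator {F₀ G : Measure ℝ} [IsProbabilityMeasure F₀]
    [IsProbabilityMeasure G] {g k : ℝ → ℝ} {M₀ : ℝ}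
    (hG : CensoringCondition G g M₀) (hk : KernelCondition k)
    {m M ε₁ ε₂ B δ η h : ℝ} (hh : 0 < h) (hh1 : h ≤ 1) (hhm : h < m) (hhM : M + 2 * h ≤ M₀)
    (hε₁ : 0 < ε₁) (hε₂ : 0 < ε₂) (hδ1 : δ ≤ 1) (hδB : δ * B ≤ ε₁ * ε₂ / 4)
    (hη1 : η ≤ ε₂ / 2) (hη2 : 4 * η / ε₂ ≤ δ / 2) (hη3 : η ≤ ε₁ * ε₂ / 8)
    (hFinc : ∀ x ∈ Icc 0 M₀, ∀ y ∈ Icc 0 M₀, x ≤ y → ε₁ * (y - x) ≤ cdf F₀ y - cdf F₀ x)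
    (hg : ∀ x ∈ Icc 0 M₀, ε₂ ≤ g x)
    (hgL : ∀ x ∈ Icc 0 M₀, ∀ y ∈ Icc 0 M₀, |g y - g x| ≤ B * |y - x|)
    (hmod : ∀ s ∈ Icc m M, ∀ x ∈ Icc (s - h) (s + h), |cdf F₀ x - cdf F₀ s| ≤ δ / 6)
    {x t : ℕ → ℝ} {n : ℕ}
    (hdev₁ : ∀ q ∈ ({k, deriv k} : Set (ℝ → ℝ)), ∀ s ∈ Icc m M,
      |kernelAverage q h (fun j => if x j ≤ t j then 1 else 0) t n s -
        ∫ u, cdf F₀ u * q ((s - u) / h) / h ^ 2 ∂G| ≤ η)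
    (hdev : ∀ q ∈ ({k, deriv k} : Set (ℝ → ℝ)), ∀ s ∈ Icc m M,
      |kernelAverage q h (fun _ => 1) t n s - ∫ u, 1 * q ((s - u) / h) / h ^ 2 ∂G| ≤ η) :
    (∀ s ∈ Icc m M, 0 < gHat k h x t n s) ∧
      MonotoneOn (naiveEstimator k h x t n) (Icc m M) := by
  have hk1 : ContDiff ℝ 1 k := hk.contDiff.of_le one_le_two
  have hkc : HasCompactSupport k := by
    rw [HasCompactSupport, hk.tsupport_eq]; exact isCompact_Icc
  have hk0 : ∀ u, u ∉ Icc (-1 : ℝ) 1 → k u = 0 := fun u hu =>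
    image_eq_zero_of_notMem_tsupport (by rwa [hk.tsupport_eq])
  have hFm : Measurable (cdf F₀) := (monotone_cdf F₀).measurable
  have hF1 : ∀ u, |cdf F₀ u| ≤ 1 := fun u => by
    rw [abs_of_nonneg (cdf_nonneg _ _)]; exact cdf_le_one _ _
  set w : ℕ → ℝ := fun j => if x j ≤ t j then 1 else 0 with hw
  set N : ℝ → ℝ := fun s => h * kernelAverage k h w t n s with hN
  set D : ℝ → ℝ := fun s => h * kernelAverage k h (fun _ => 1) t n s with hD
  -- The estimators carry 1 / h instead of 1 / h², so the deviation bound is multiplied by h ≤ 1 and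
  -- η still works.
  have hscale : ∀ (v : ℝ → ℝ) (A : ℝ) (s : ℝ),
      |A - ∫ u, v u * k ((s - u) / h) / h ^ 2 ∂G| ≤ η →
      |h * A - ∫ u, v u * k ((s - u) / h) / h ∂G| ≤ η := fun v A s hA => by
    have h1 : ∫ u, v u * k ((s - u) / h) / h ∂G =
        h * ∫ u, v u * k ((s - u) / h) / h ^ 2 ∂G := by
      rw [← integral_const_mul]
      refine integral_congr_ae (ae_of_all _ fun u => ?_)
      field_simp
    rw [h1, ← mul_sub, abs_mul, abs_of_pos hh]
    calc _ ≤ 1 * η := mul_le_mul hh1 hA (abs_nonneg _) zero_le_one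
      _ = η := one_mul η
  have key : ∀ s ∈ Icc m M, 0 < D s ∧ |N s / D s - cdf F₀ s| ≤ 2 * (δ / 6) + 4 * η / ε₂ :=
    fun s hs => by
    have h1 := hscale _ _ _ (hdev₁ k (by simp) s hs)
    have h2 := hscale (fun _ => 1) _ _ (hdev k (by simp) s hs)
    simp only [one_mul] at h2
    exact abs_div_sub_le_of_abs_sub_le (cdf_nonneg _ _) (cdf_le_one _ _) hε₂
      (le_integral_kernel hG.measurable_density hG.density_nonneg hG.eq_withDensity
        hk1.continuous hk.nonneg hk.integral_eq_one hk0 hkc hg hh (by linarith [hs.1])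
        (by linarith [hs.2])) hη1
      (abs_integral_mul_kernel_sub_le hk1.continuous hk.nonneg hk0 hkc hFm hF1 hh (hmod s hs))
      h1 h2
  have hbw : ∀ s ∈ Icc m M, h < s := fun s hs => hhm.trans_le hs.1
  refine ⟨fun s hs => ?_, ?_⟩
  · rw [gHat_eq_kernelAverage hh (hbw s hs)]
    exact (key s hs).1
  have hmono : MonotoneOn (fun s => N s / D s) (Icc m M) := by
    refine monotoneOn_div_of_hasDerivAt
      (fun s _ => hasDerivAt_mul_kernelAverage (hk1.differentiable one_ne_zero) hh w t n s)
      (fun s _ => hasDerivAt_mul_kernelAverage (hk1.differentiable one_ne_zero) hh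
        (fun _ => 1) t n s) (fun s hs => (key s hs).1) fun s hs => ?_
    set l := N s / D s with hl
    have hlF : |l - cdf F₀ s| ≤ 2 * (δ / 6) + 4 * η / ε₂ := (key s hs).2
    have hl2 : |l| ≤ 2 := by
      have h1 := abs_le.1 hlF
      have h2 := cdf_nonneg F₀ s
      have h3 := cdf_le_one F₀ s
      rw [abs_le]
      constructor <;> linarith
    -- Error budget: l is within δ / 3 + δ / 2 of F₀(s), and the modulus of continuity contributes
    -- the remaining δ / 6 on the window.
    have hlow := le_integral_sub_mul_deriv_kernel (l := l) hG.measurable_density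
      hG.density_nonneg hG.eq_withDensity hk1 hk.nonneg hk.integral_eq_one hk0 hkc hFm hF1
      hε₁.le hFinc hg hgL hh (by linarith [hs.1]) (by linarith [hs.2] : s + 2 * h ≤ M₀)
      (δ := δ) fun y hy => by
        have h1 := abs_sub_le (cdf F₀ y) (cdf F₀ s) l
        rw [abs_sub_comm (cdf F₀ s) l] at h1
        linarith [hmod s hs y hy]
    have hsplit : ∫ u, (cdf F₀ u - l) * deriv k ((s - u) / h) / h ^ 2 ∂G =
        (∫ u, cdf F₀ u * deriv k ((s - u) / h) / h ^ 2 ∂G) -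
          l * ∫ u, 1 * deriv k ((s - u) / h) / h ^ 2 ∂G := by
      obtain ⟨K, hK⟩ := (hk1.continuous_deriv le_rfl).bounded_above_of_compact_support hkc.deriv
      have hdc := hk1.continuous_deriv le_rfl
      have hint : Integrable (fun u => deriv k ((s - u) / h) / h ^ 2) G := by
        refine Integrable.of_bound (C := K / h ^ 2) (by fun_prop) (ae_of_all _ fun u => ?_)
        rw [norm_div, Real.norm_of_nonneg (pow_nonneg hh.le 2)]
        gcongr
        exact hK _
      simp only [one_mul, mul_div_assoc]
      rw [← integral_const_mul, ← integral_sub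
        (hint.bdd_mul hFm.aestronglyMeasurable (ae_of_all _ hF1)) (hint.const_mul l)]
      simp only [sub_mul]
    rw [hsplit] at hlow
    have e1 := abs_le.1 (hdev₁ (deriv k) (by simp) s hs)
    have e2 := hdev (deriv k) (by simp) s hs
    have e3 : |l * (kernelAverage (deriv k) h (fun _ => 1) t n s -
        ∫ u, 1 * deriv k ((s - u) / h) / h ^ 2 ∂G)| ≤ 2 * η := by
      rw [abs_mul]
      exact mul_le_mul hl2 e2 (abs_nonneg _) zero_le_two
    have e4 := abs_le.1 e3
    have e5 : 0 < ε₁ * ε₂ := mul_pos hε₁ hε₂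
    have e6 := mul_sub l (kernelAverage (deriv k) h (fun _ => 1) t n s)
      (∫ u, 1 * deriv k ((s - u) / h) / h ^ 2 ∂G)
    rw [e6] at e4
    -- The lower bound is at least 3ε₁ε₂ / 4, while the deviations cost η + 2η ≤ 3ε₁ε₂ / 8.
    linarith [e1.1, e4.2]
  refine hmono.congr fun s hs => ?_
  simp only [naiveEstimator, gHat_eq_kernelAverage hh (hbw s hs),
    gHatSub_one_eq_kernelAverage hh (hbw s hs), hN, hD, hw]

/-- With probability tending to one, the naive estimator is well defined (its denominator is
positive) and monotonically increasing on `[m, M]`. -/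
theorem theorem3p3 {Ω : Type*} [MeasurableSpace Ω] (P : Measure Ω) [IsProbabilityMeasure P]
    (F₀ G : Measure ℝ) [IsProbabilityMeasure F₀] [IsProbabilityMeasure G]
    (f₀ g k : ℝ → ℝ) (M₀ : ℝ)
    (hF : EventTimeCondition F₀ f₀ M₀) (hG : CensoringCondition G g M₀) (hk : KernelCondition k)
    (X T : ℕ → Ω → ℝ) (hXT : IsCurrentStatusModel P F₀ G X T)
    (c α : ℝ) (hc : 0 < c) (hα : α ∈ Ioo (0 : ℝ) (1 / 3))
    (m M : ℝ) (hm : 0 < m) (hmM : m < M) (hM : M < M₀) :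
    Tendsto
      (fun n : ℕ => P {ω |
        (∀ t ∈ Icc m M,
          0 < gHat k (bandwidth c α n) (fun j => X j ω) (fun j => T j ω) n t) ∧
        MonotoneOn
          (naiveEstimator k (bandwidth c α n) (fun j => X j ω) (fun j => T j ω) n) (Icc m M)})
      atTop (𝓝 1) := by
  obtain ⟨ε₁, hε₁, hf⟩ := hF.away_from_zero
  obtain ⟨ε₂, hε₂, hg⟩ := hG.away_from_zero
  obtain ⟨B, hB⟩ := hG.bounded_deriv
  have hB0 : 0 ≤ B := (abs_nonneg _).trans (hB 0 ⟨le_rfl, by linarith⟩)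
  have hgL : ∀ x ∈ Icc 0 M₀, ∀ y ∈ Icc 0 M₀, |g y - g x| ≤ B * |y - x| := fun x hx y hy =>
    (convex_Icc 0 M₀).norm_image_sub_le_of_norm_derivWithin_le hG.differentiableOn hB hx hy
  have hFinc : ∀ x ∈ Icc 0 M₀, ∀ y ∈ Icc 0 M₀, x ≤ y →
      ε₁ * (y - x) ≤ cdf F₀ y - cdf F₀ x := fun x hx y hy hxy =>
    mul_sub_le_cdf_sub hF.eq_withDensity hε₁.le hf hx.1 hy.2 hxy
  have : NullSingletonClass F₀ := by
    rw [hF.eq_withDensity]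
    infer_instance
  have hunif := isCompact_Icc.uniformContinuousOn_of_continuous
    (continuous_cdf (μ := F₀)).continuousOn (s := Icc 0 M₀)
  have hε : 0 < ε₁ * ε₂ := mul_pos hε₁ hε₂
  obtain ⟨δ, hδ, hδ1, hδB⟩ : ∃ δ > 0, δ ≤ 1 ∧ δ * B ≤ ε₁ * ε₂ / 4 := by
    -- Dividing by B + 1 covers the case B = 0.
    refine ⟨min 1 (ε₁ * ε₂ / 4 / (B + 1)), by positivity, min_le_left _ _, ?_⟩
    calc _ ≤ ε₁ * ε₂ / 4 / (B + 1) * (B + 1) := by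
          gcongr
          · exact min_le_right _ _
          · linarith
      _ = _ := by field_simp
  obtain ⟨r, hr, hmod⟩ := Metric.uniformContinuousOn_iff.1 hunif (δ / 6) (by positivity)
  obtain ⟨η, hη, hη1, hη2, hη3⟩ :
      ∃ η > 0, η ≤ ε₂ / 2 ∧ 4 * η / ε₂ ≤ δ / 2 ∧ η ≤ ε₁ * ε₂ / 8 := by
    refine ⟨min (ε₂ / 2) (min (δ * ε₂ / 8) (ε₁ * ε₂ / 8)), by positivity, min_le_left _ _, ?_,
      (min_le_right _ _).trans (min_le_right _ _)⟩
    rw [div_le_iff₀ hε₂]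
    have := (min_le_right (ε₂ / 2) (min (δ * ε₂ / 8) (ε₁ * ε₂ / 8))).trans (min_le_left _ _)
    linarith
  have hk1 : ContDiff ℝ 1 k := hk.contDiff.of_le one_le_two
  -- The second derivative of k is needed only here: it makes k' a C¹ function, hence Lipschitz as
  -- the grid argument requires.
  have hdk1 : ContDiff ℝ 1 (deriv k) :=
    (contDiff_succ_iff_deriv (n := 1).1 hk.contDiff).2.2
  have hks : tsupport k ⊆ Icc (-1) 1 := hk.tsupport_eq.le
  have hdks : tsupport (deriv k) ⊆ Icc (-1) 1 := tsupport_deriv_subset.trans hks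
  have hi : Measurable fun p : ℝ × ℝ => if p.1 ≤ p.2 then (1 : ℝ) else 0 :=
    Measurable.ite (measurableSet_le measurable_fst measurable_snd) measurable_const
      measurable_const
  have hi1 : ∀ p : ℝ × ℝ, |if p.1 ≤ p.2 then (1 : ℝ) else 0| ≤ 1 := fun p => by
    split_ifs <;> simp
  have hc1 : ∀ p : ℝ × ℝ, |(fun _ : ℝ × ℝ => (1 : ℝ)) p| ≤ 1 := fun p => by simp
  have d1 := hXT.tendsto_measureReal_exists_lt_abs_sub hG hi hi1 hk1 hks hm hmM.le hM hη hc hα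
  have d2 := hXT.tendsto_measureReal_exists_lt_abs_sub hG hi hi1 hdk1 hdks hm hmM.le hM hη hc hα
  have d3 := hXT.tendsto_measureReal_exists_lt_abs_sub hG (measurable_const (a := (1 : ℝ))) hc1
    hk1 hks hm hmM.le hM hη hc hα
  have d4 := hXT.tendsto_measureReal_exists_lt_abs_sub hG (measurable_const (a := (1 : ℝ))) hc1
    hdk1 hdks hm hmM.le hM hη hc hα
  simp only [integral_ite_le] at d1 d2
  simp only [integral_const, probReal_univ, one_smul] at d3 d4
  have hlim := ((d1.add d2).add (d3.add d4)).const_sub 1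
  simp only [add_zero, sub_zero] at hlim
  have hbw := tendsto_bandwidth (c := c) hα.1
  have hreal := tendsto_of_tendsto_of_tendsto_of_le_of_le' hlim tendsto_const_nhds
    (f := fun n : ℕ => P.real {ω |
        (∀ t ∈ Icc m M,
          0 < gHat k (bandwidth c α n) (fun j => X j ω) (fun j => T j ω) n t) ∧
        MonotoneOn
          (naiveEstimator k (bandwidth c α n) (fun j => X j ω) (fun j => T j ω) n) (Icc m M)})
    ?_ (Eventually.of_forall fun n => measureReal_le_one)
  · have := (ENNReal.continuous_ofReal.tendsto 1).comp hreal
    simpa [Function.comp_def] using this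
  filter_upwards [eventually_gt_atTop 0, hbw.eventually_lt_const one_pos,
    hbw.eventually_lt_const hm, hbw.eventually_lt_const (half_pos (sub_pos.2 hM)),
    hbw.eventually_lt_const hr] with n hn h1 hhm hhM hhr
  have hh := bandwidth_pos (α := α) hc hn
  set h := bandwidth c α n with hh_def
  rw [sub_le_iff_le_add]
  -- The good event is not shown to be measurable, so complements are avoided: the whole space is
  -- covered by the good event and four bad ones, and subadditivity suffices.
  refine (probReal_univ (μ := P)).symm.le.trans <| (measureReal_mono fun ω _ => ?_).trans ((measureReal_union_le _ _).trans
    (add_le_add_right ((measureReal_union_le _ _).trans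
      (add_le_add (measureReal_union_le _ _) (measureReal_union_le _ _))) _))
  by_contra hω
  simp only [mem_union, not_or] at hω
  obtain ⟨hω0, ⟨g1, g2⟩, g3, g4⟩ := hω
  simp only [mem_ofPred_eq, not_exists, not_and, not_lt] at g1 g2 g3 g4
  refine hω0 (pos_and_monotoneOn_naiveEstimator hG hk hh h1.le hhm (by linarith) hε₁ hε₂ hδ1 hδB
    hη1 hη2 hη3 hFinc hg hgL (fun s hs y hy => ?_) ?_ ?_)
  · have hs0 : s ∈ Icc 0 M₀ := ⟨by linarith [hs.1], by linarith [hs.2]⟩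
    have hy0 : y ∈ Icc 0 M₀ := ⟨by linarith [hs.1, hy.1], by linarith [hs.2, hy.2]⟩
    refine (hmod y hy0 s hs0 ?_).le
    rw [Real.dist_eq, abs_lt]
    constructor <;> linarith [hy.1, hy.2]
  · rintro q (rfl | rfl)
    exacts [g1, g2]
  · rintro q (rfl | rfl)
    exacts [g3, g4]
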